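/- Let $k$ be a field, $n\ge 0$, and for a $k$-algebra $A$ let $S_{A,d}$ be the $A$-module of homogeneous polynomials of degree $d$ in $A[x_0,\dots,x_n]$ (with $S_{A,-1}=0$). Let $p$ be the Hilbert polynomial of a closed subscheme of $\mathbb{P}^n_k$, let $r$ be its Gotzmann number, i.e. the number of binomials in the expression $p(d)=\sum_{i=0}^{r-1}\binom{d+a_i-i}{a_i}$ with $a_0\ge\dots\ge a_{r-1}\ge 0$, and let $R\ge r$. Let $Q_p$ be the quiver with four vertices and $2n+3$ arrows: $\mu_0,\dots,\mu_n$ from the first vertex to the second, $\rho$ from the second to the third, and $M_0,\dots,M_n$ from the third to the fourth. For a $k$-algebra $A$ let $\mathbf{C}^p(A)$ be the set of representations $(\mu,\rho,M)$ of $Q_p$ on the $A$-modules $S_{A,R-1},\ S_{A,R},\ A^{p(R)},\ A^{p(R+1)}$ such that 1. $\mu_i: S_{A,R-1}\to S_{A,R}$ is multiplication by $x_i$ for $0\le i\le n$; 2. $\rho: S_{A,R}\to A^{p(R)}$ is surjective; 3. $\Sigma M:(A^{p(R)})^{n+1}\to A^{p(R+1)}$, $(e_0,\dots,e_n)\mapsto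 \sum_i M_i(e_i)$, is surjective; 4. $M_i\circ\rho\circ\mu_j=M_j\circ\rho\circ\mu_i$ for all $0\le i,j\le n$. With base change $(\rho,M)\mapsto(\rho\otimes_A B,M\otimes_A B)$ along $k$-algebra maps $A\to B$, $\mathbf{C}^p$ is a functor from $k$-algebras to sets. **Proposition.** There is a $k$-scheme $C^p$ with an isomorphism $\mathrm{Hom}_k(\mathrm{Spec}\,A,C^p)\cong\mathbf{C}^p(A)$, functorial in the $k$-algebra $A$. The scheme $C^p$ is a locally closed subscheme of the affine space over $k$ of all tuples of matrices $(\rho,M_0,\dots,M_n)$: there is an immersion over $k$ of $C^p$ into this space that sends each $A$-point to the point given by the entries of its matrices (with respect to the monomials of $S_{A,R}$ and the standard bases). The $k$-points of $C^p$ are representations of $Q_p$: the isomorphism for $A=k$ identifies them with the representations of $Q_p$ on the vector spaces $S_{k,R-1},\ S_{k,R},\ k^{p(R)},\ k^{p(R+1)}$ that satisfy 1–4, and these representations have dimension vector $\left(\binom{R-1+n}{R-1},\binom{R+n}{R},p(R),p(R+1)\right)$ (first entry $0$ if $R=0$). -/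

import Mathlib

open CategoryTheory AlgebraicGeometry

universe u

namespace HilbertQuiver

noncomputable section

/-! ### Homogeneous polynomials, Hilbert polynomials and Gotzmann numbers -/

/-- `S_{A,d}`: the `A`-submodule of `A[x_0, …, x_n]` of homogeneous polynomials of degree `d`.
The degree is an integer, so that `S_{A,-1} = 0`. -/
def gradedPiece (A : Type u) [CommRing A] (n : ℕ) (d : ℤ) :
    Submodule A (MvPolynomial (Fin (n + 1)) A) :=
  MvPolynomial.restrictSupport A {m | (m.degree : ℤ) = d}

/-- The Hilbert function `d ↦ dim_k (S_d / I_d)` of the subscheme of `ℙ^n` cut out by a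
homogeneous ideal `I` of `S = k[x_0, …, x_n]`. -/
def hilbertFunction {k : Type u} [Field k] {n : ℕ} (I : Ideal (MvPolynomial (Fin (n + 1)) k))
    (d : ℕ) : ℕ :=
  Module.finrank k (gradedPiece k n d ⧸
    (I.restrictScalars k).comap (gradedPiece k n d).subtype)

/-- `p` is the Hilbert polynomial of a closed subscheme of `ℙ^n` over `k`. The closed subschemes
are those cut out by homogeneous ideals, and the Hilbert polynomial is the polynomial that agrees
with the Hilbert function in all large degrees. -/
def IsHilbertPolynomial (k : Type u) [Field k] (n : ℕ) (p : Polynomial ℚ) : Prop :=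
  ∃ I : Ideal (MvPolynomial (Fin (n + 1)) k),
    (∀ f ∈ I, ∀ d : ℕ, MvPolynomial.homogeneousComponent d f ∈ I) ∧
      ∀ᶠ d : ℕ in Filter.atTop, p.eval (d : ℚ) = hilbertFunction I d

/-- `r` is the Gotzmann number of `p`, that is, the number of binomials in the expression
`p(d) = ∑_{0 ≤ i < r} (d + a_i - i choose a_i)` with `a_0 ≥ a_1 ≥ … ≥ a_{r-1} ≥ 0`. Here
`Polynomial.preHilbertPoly ℚ a i` is the polynomial `d ↦ (d + a - i choose a)`. -/
def IsGotzmannNumber (p : Polynomial ℚ) (r : ℕ) : Prop :=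
  ∃ a : Fin r → ℕ, Antitone a ∧ p = ∑ i : Fin r, Polynomial.preHilbertPoly ℚ (a i) i

/-! ### The quiver -/

/-- The four vertices of the quiver `Q_p`. -/
inductive Vertex (n : ℕ) : Type
  | one
  | two
  | three
  | four

/-- The `2n + 3` arrows of the quiver `Q_p`: `μ_0, …, μ_n` from the first vertex to the second,
`ρ` from the second to the third, and `M_0, …, M_n` from the third to the fourth. -/
inductive Arrow (n : ℕ) : Vertex n → Vertex n → Type
  | mu (i : Fin (n + 1)) : Arrow n .one .two
  | rho : Arrow n .two .three
  | M (i : Fin (n + 1)) : Arrow n .three .four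

instance (n : ℕ) : Quiver (Vertex n) := ⟨Arrow n⟩

/-- The representations of the quiver `Q_p` over `A`: a module at each vertex and a linear map
along each arrow. -/
abbrev QuiverRep (A : Type u) [CommRing A] (n : ℕ) := Vertex n ⥤q ModuleCat.{u} A

/-- The dimension vector `(R-1+n choose R-1, R+n choose R, a, b)`, whose first entry is `0`
for `R = 0`. -/
def dimVector (n R a b : ℕ) : Vertex n → ℕ
  | .one => match R with
    | 0 => 0
    | R' + 1 => (R' + n).choose R'
  | .two => (R + n).choose R
  | .three => a
  | .four => b

/-- The modules `S_{A,R-1}`, `S_{A,R}`, `A^a`, `A^b` at the vertices. -/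
def vertexSpace (n R a b : ℕ) (A : Type u) [CommRing A] : Vertex n → ModuleCat.{u} A
  | .one => ModuleCat.of A (gradedPiece A n ((R : ℤ) - 1))
  | .two => ModuleCat.of A (gradedPiece A n R)
  | .three => ModuleCat.of A (Fin a → A)
  | .four => ModuleCat.of A (Fin b → A)

/-- The representations of `Q_p` over `A` with the modules `S_{A,R-1}`, `S_{A,R}`, `A^a`, `A^b`
at the vertices: a linear map along each arrow. -/
def Rep (n R a b : ℕ) (A : Type u) [CommRing A] : Type u :=
  ∀ v w : Vertex n, (v ⟶ w) → (vertexSpace n R a b A v →ₗ[A] vertexSpace n R a b A w)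

namespace Rep

variable {n R a b : ℕ} {A : Type u} [CommRing A]

/-- The map `μ_i : S_{A,R-1} → S_{A,R}`. -/
def mu (φ : Rep n R a b A) (i : Fin (n + 1)) :
    gradedPiece A n ((R : ℤ) - 1) →ₗ[A] gradedPiece A n R :=
  φ .one .two (.mu i)

/-- The map `ρ : S_{A,R} → A^a`. -/
def rho (φ : Rep n R a b A) : gradedPiece A n R →ₗ[A] (Fin a → A) :=
  φ .two .three .rho

/-- The map `M_i : A^a → A^b`. -/
def M (φ : Rep n R a b A) (i : Fin (n + 1)) : (Fin a → A) →ₗ[A] (Fin b → A) :=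
  φ .three .four (.M i)

/-- The map `ΣM : (A^a)^{n+1} → A^b`, `(e_0, …, e_n) ↦ M_0 e_0 + … + M_n e_n`. -/
def sumM (φ : Rep n R a b A) : (Fin (n + 1) → Fin a → A) →ₗ[A] (Fin b → A) :=
  ∑ i, φ.M i ∘ₗ LinearMap.proj i

/-- The underlying representation of the quiver. -/
def toQuiverRep (φ : Rep n R a b A) : QuiverRep A n where
  obj := vertexSpace n R a b A
  map {v w} e := ModuleCat.ofHom (φ v w e)

/-- The conditions that define `C^p`. -/
structure IsAdmissible (φ : Rep n R a b A) : Prop where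
  /-- `μ_i` is the multiplication by `x_i`. -/
  mu_apply : ∀ (i : Fin (n + 1)) (f : gradedPiece A n ((R : ℤ) - 1)),
    (φ.mu i f : MvPolynomial (Fin (n + 1)) A) = MvPolynomial.X i * (f : MvPolynomial (Fin (n + 1)) A)
  surjective_sumM : Function.Surjective φ.sumM
  surjective_rho : Function.Surjective φ.rho
  comm : ∀ i j : Fin (n + 1), φ.M i ∘ₗ φ.rho ∘ₗ φ.mu j = φ.M j ∘ₗ φ.rho ∘ₗ φ.mu i

end Rep

/-! ### Base change -/

section BaseChange

variable (n R a b : ℕ)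

/-- The index set of the standard basis at each vertex: the monomials of degree `R - 1` and `R`,
and the standard bases of `A^a` and `A^b`. -/
def VertexIndex : Vertex n → Type
  | .one => {m : Fin (n + 1) →₀ ℕ | (m.degree : ℤ) = (R : ℤ) - 1}
  | .two => {m : Fin (n + 1) →₀ ℕ | (m.degree : ℤ) = (R : ℤ)}
  | .three => Fin a
  | .four => Fin b

/-- The basis of `S_{A,d}` that consists of the monomials of degree `d`. -/
def gradedPieceBasis (A : Type u) [CommRing A] (d : ℤ) :
    Module.Basis {m : Fin (n + 1) →₀ ℕ | (m.degree : ℤ) = d} A (gradedPiece A n d) :=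
  MvPolynomial.basisRestrictSupport A _

/-- The standard basis of the module at each vertex. -/
def vertexBasis (A : Type u) [CommRing A] :
    ∀ v : Vertex n, Module.Basis (VertexIndex n R a b v) A (vertexSpace n R a b A v)
  | .one => gradedPieceBasis n A _
  | .two => gradedPieceBasis n A _
  | .three => Pi.basisFun A (Fin a)
  | .four => Pi.basisFun A (Fin b)

variable {A B : Type u} [CommRing A] [CommRing B] (f : A →+* B)

/-- The map `S_{A,d} → S_{B,d}` which applies `f` to the coefficients. -/
def gradedPieceMap (d : ℤ) : gradedPiece A n d →ₛₗ[f] gradedPiece B n d where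
  toFun g := ⟨MvPolynomial.map f g.1, fun _ hm =>
    g.2 (MvPolynomial.support_map_subset f g.1 hm)⟩
  map_add' g h := Subtype.ext (map_add (MvPolynomial.map f) g.1 h.1)
  map_smul' c g := Subtype.ext (by
    simp [MvPolynomial.smul_eq_C_mul])

/-- The map `A^c → B^c` which applies `f` to the coordinates. -/
def piMap (c : ℕ) : (Fin c → A) →ₛₗ[f] (Fin c → B) where
  toFun x i := f (x i)
  map_add' x y := by ext i; simp
  map_smul' c x := by ext i; simp

/-- The canonical map from the module at a vertex over `A` to the one over `B`. It identifies the
latter with the base change of the former, see `vertexMap_basis`. -/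
def vertexMap : ∀ v : Vertex n, vertexSpace n R a b A v →ₛₗ[f] vertexSpace n R a b B v
  | .one => gradedPieceMap n f _
  | .two => gradedPieceMap n f _
  | .three => piMap f a
  | .four => piMap f b

lemma gradedPieceBasis_coe (A : Type u) [CommRing A] (d : ℤ)
    (m : {m : Fin (n + 1) →₀ ℕ | (m.degree : ℤ) = d}) :
    (gradedPieceBasis n A d m : MvPolynomial (Fin (n + 1)) A) = MvPolynomial.monomial m.1 1 := by
  have h : gradedPieceBasis n A d m = ⟨MvPolynomial.monomial m.1 1,
      (MvPolynomial.monomial_mem_restrictSupport A).2 (Or.inl m.2)⟩ := by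
    rw [Module.Basis.apply_eq_iff]
    ext m'
    change MvPolynomial.coeff m'.1 (MvPolynomial.monomial m.1 (1 : A)) = _
    classical
    rw [MvPolynomial.coeff_monomial, Finsupp.single_apply]
    simp only [Subtype.ext_iff]
  rw [h]

lemma gradedPieceMap_basis (d : ℤ) (m : {m : Fin (n + 1) →₀ ℕ | (m.degree : ℤ) = d}) :
    gradedPieceMap n f d (gradedPieceBasis n A d m) = gradedPieceBasis n B d m := by
  apply Subtype.ext
  change MvPolynomial.map f (gradedPieceBasis n A d m).1 = _
  rw [gradedPieceBasis_coe, gradedPieceBasis_coe, MvPolynomial.map_monomial, map_one]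

lemma piMap_basis (c : ℕ) (i : Fin c) :
    piMap f c (Pi.basisFun A (Fin c) i) = Pi.basisFun B (Fin c) i := by
  ext j
  change f (Pi.basisFun A (Fin c) i j) = Pi.basisFun B (Fin c) i j
  simp [Pi.basisFun_apply, Pi.single_apply, apply_ite f]

lemma vertexMap_basis (v : Vertex n) (i : VertexIndex n R a b v) :
    vertexMap n R a b f v (vertexBasis n R a b A v i) = vertexBasis n R a b B v i := by
  cases v with
  | one => exact gradedPieceMap_basis n f _ i
  | two => exact gradedPieceMap_basis n f _ i
  | three => exact piMap_basis f a i
  | four => exact piMap_basis f b i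

variable {n R a b}

/-- The base change `φ ⊗_A B` of a representation along `f : A → B`: the `B`-linear maps with
the same values on the standard bases, see `baseChange_apply`. -/
def Rep.baseChange (φ : Rep n R a b A) : Rep n R a b B := fun v w e =>
  (vertexBasis n R a b B v).constr ℕ fun i =>
    vertexMap n R a b f w (φ v w e (vertexBasis n R a b A v i))

/-- `(φ ⊗_A B)(x ⊗ 1) = φ(x) ⊗ 1`. -/
lemma Rep.baseChange_apply (φ : Rep n R a b A) {v w : Vertex n} (e : v ⟶ w)
    (x : vertexSpace n R a b A v) :
    φ.baseChange f v w e (vertexMap n R a b f v x) = vertexMap n R a b f w (φ v w e x) := by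
  have key : ((φ.baseChange f v w e).comp (vertexMap n R a b f v) :
      vertexSpace n R a b A v →ₛₗ[f] vertexSpace n R a b B w) =
      (vertexMap n R a b f w).comp (φ v w e) := by
    refine (vertexBasis n R a b A v).ext fun i => ?_
    simp only [LinearMap.comp_apply, vertexMap_basis]
    exact (vertexBasis n R a b B v).constr_basis ℕ _ i
  exact LinearMap.congr_fun key x

/-- The base change is the only representation with the property in `baseChange_apply`. -/
lemma Rep.eq_baseChange (φ : Rep n R a b A) (ψ : Rep n R a b B)
    (h : ∀ (v w : Vertex n) (e : v ⟶ w) (x : vertexSpace n R a b A v),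
      ψ v w e (vertexMap n R a b f v x) = vertexMap n R a b f w (φ v w e x)) :
    ψ = φ.baseChange f := by
  funext v w e
  refine (vertexBasis n R a b B v).ext fun i => ?_
  rw [← vertexMap_basis (f := f), h, Rep.baseChange_apply]

lemma vertexMap_id (v : Vertex n) (x : vertexSpace n R a b A v) :
    vertexMap n R a b (RingHom.id A) v x = x := by
  cases v with
  | one => exact Subtype.ext (MvPolynomial.map_id x.1)
  | two => exact Subtype.ext (MvPolynomial.map_id x.1)
  | three => rfl
  | four => rfl

lemma vertexMap_comp {C : Type u} [CommRing C] (g : B →+* C) (v : Vertex n)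
    (x : vertexSpace n R a b A v) :
    vertexMap n R a b (g.comp f) v x = vertexMap n R a b g v (vertexMap n R a b f v x) := by
  cases v with
  | one => exact Subtype.ext (MvPolynomial.map_map f g x.1).symm
  | two => exact Subtype.ext (MvPolynomial.map_map f g x.1).symm
  | three => rfl
  | four => rfl

lemma Rep.baseChange_id (φ : Rep n R a b A) : φ.baseChange (RingHom.id A) = φ := by
  refine (Rep.eq_baseChange (RingHom.id A) φ φ fun v w e x => ?_).symm
  rw [vertexMap_id, vertexMap_id]

lemma Rep.baseChange_comp {C : Type u} [CommRing C] (g : B →+* C) (φ : Rep n R a b A) :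
    φ.baseChange (g.comp f) = (φ.baseChange f).baseChange g := by
  refine (Rep.eq_baseChange (g.comp f) φ _ fun v w e x => ?_).symm
  rw [vertexMap_comp, vertexMap_comp, Rep.baseChange_apply, Rep.baseChange_apply]

lemma Rep.IsAdmissible.baseChange {φ : Rep n R a b A} (h : φ.IsAdmissible) :
    (φ.baseChange f).IsAdmissible := by
  have hb (v w : Vertex n) (e : v ⟶ w) (x : vertexSpace n R a b A v) := φ.baseChange_apply f e x
  have hmu (i : Fin (n + 1)) (x : gradedPiece A n ((R : ℤ) - 1)) :
      (φ.baseChange f).mu i (gradedPieceMap n f _ x) = gradedPieceMap n f _ (φ.mu i x) :=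
    hb .one .two (.mu i) x
  have hrho (x : gradedPiece A n R) :
      (φ.baseChange f).rho (gradedPieceMap n f _ x) = piMap f a (φ.rho x) :=
    hb .two .three .rho x
  have hM (i : Fin (n + 1)) (x : Fin a → A) :
      (φ.baseChange f).M i (piMap f a x) = piMap f b (φ.M i x) :=
    hb .three .four (.M i) x
  refine ⟨fun i g => ?_, ?_, ?_, fun i j => ?_⟩
  · have key : (gradedPiece B n R).subtype ∘ₗ (φ.baseChange f).mu i =
        LinearMap.mulLeft B (MvPolynomial.X i) ∘ₗ (gradedPiece B n ((R : ℤ) - 1)).subtype := by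
      refine (gradedPieceBasis n B _).ext fun m => ?_
      rw [← gradedPieceMap_basis n f]
      simp only [LinearMap.comp_apply, hmu, Submodule.subtype_apply, LinearMap.mulLeft_apply]
      change MvPolynomial.map f (φ.mu i _).1 = MvPolynomial.X i * MvPolynomial.map f _
      rw [h.mu_apply, map_mul, MvPolynomial.map_X]
    exact LinearMap.congr_fun key g
  · rw [← LinearMap.range_eq_top, eq_top_iff, ← (Pi.basisFun B (Fin b)).span_eq,
      Submodule.span_le]
    rintro _ ⟨i, rfl⟩
    obtain ⟨x, hx⟩ := h.surjective_sumM (Pi.basisFun A (Fin b) i)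
    refine ⟨fun l => piMap f a (x l), ?_⟩
    rw [← piMap_basis f, ← hx]
    simp only [Rep.sumM, LinearMap.sum_apply, LinearMap.comp_apply, LinearMap.proj_apply, hM,
      map_sum]
  · rw [← LinearMap.range_eq_top, eq_top_iff, ← (Pi.basisFun B (Fin a)).span_eq,
      Submodule.span_le]
    rintro _ ⟨i, rfl⟩
    obtain ⟨x, hx⟩ := h.surjective_rho (Pi.basisFun A (Fin a) i)
    exact ⟨gradedPieceMap n f _ x, by rw [hrho, hx, piMap_basis]⟩
  · refine (gradedPieceBasis n B _).ext fun m => ?_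
    rw [← gradedPieceMap_basis n f]
    simp only [LinearMap.comp_apply, hmu, hrho, hM]
    exact congrArg (piMap f b) (LinearMap.congr_fun (h.comm i j) _)

end BaseChange

/-! ### The functor `C^p` -/

/-- The value of the functor `C^p` at `A`: the tuples `(μ, ρ, M)` that satisfy the conditions. -/
def CpPoint (n R a b : ℕ) (A : Type u) [CommRing A] : Type u :=
  {φ : Rep n R a b A // φ.IsAdmissible}

/-- The functor `C^p` from `k`-algebras to sets. -/
def CpFunctor (k : Type u) [Field k] (n R a b : ℕ) : CommAlgCat.{u} k ⥤ Type u where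
  obj A := CpPoint n R a b A
  map {A B} f := ↾fun φ => ⟨φ.1.baseChange (f.hom : A →+* B), φ.2.baseChange (f.hom : A →+* B)⟩
  map_id A := by
    ext φ
    exact Subtype.ext (Rep.baseChange_id φ.1)
  map_comp {A B C} f g := by
    ext φ
    exact Subtype.ext (Rep.baseChange_comp (f.hom : A →+* B) (g.hom : B →+* C) φ.1)

/-- The functor of points `A ↦ Hom_k(Spec A, X)` of a `k`-scheme `X`, on `k`-algebras. -/
def pointFunctor (k : Type u) [Field k] (X : Over (Spec (CommRingCat.of k))) :
    CommAlgCat.{u} k ⥤ Type u :=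
  (algSpec (CommRingCat.of k)).rightOp ⋙ yoneda.obj X

/-! ### The affine space of matrices -/

/-- The matrix entries of a pair `(ρ, M)`: a row and a column (a monomial of degree `R`) for `ρ`,
an index `i`, a row and a column for `M_i`. -/
abbrev Entry (n R a b : ℕ) : Type :=
  (Fin a × {m : Fin (n + 1) →₀ ℕ // (m.degree : ℤ) = R}) ⊕ (Fin (n + 1) × Fin b × Fin a)

/-- The entries of the matrices of `ρ, M_0, …, M_n` in the standard bases. -/
def Rep.entry {n R a b : ℕ} {A : Type u} [CommRing A] (φ : Rep n R a b A) :
    Entry n R a b → A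
  | .inl (i, m) => φ.rho ⟨MvPolynomial.monomial m.1 1,
      (MvPolynomial.monomial_mem_restrictSupport A).2 (Or.inl m.2)⟩ i
  | .inr (l, i, j) => φ.M l (Pi.single j 1) i

/-- The algebra of polynomials in the matrix entries. -/
abbrev entryAlgebra (k : Type u) [Field k] (n R a b : ℕ) : CommAlgCat.{u} k :=
  CommAlgCat.of k (MvPolynomial (Entry n R a b) k)

/-- The affine space over `k` of all tuples of matrices `(ρ, M_0, …, M_n)`. -/
def matrixSpace (k : Type u) [Field k] (n R a b : ℕ) : Over (Spec (CommRingCat.of k)) :=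
  (algSpec (CommRingCat.of k)).obj (Opposite.op (entryAlgebra k n R a b))

/-- The `A`-point of the affine space of matrices with prescribed entries. -/
def matrixPoint {k : Type u} [Field k] {n R a b : ℕ} (A : CommAlgCat.{u} k)
    (c : Entry n R a b → A) :
    (algSpec (CommRingCat.of k)).obj (Opposite.op A) ⟶ matrixSpace k n R a b :=
  (algSpec (CommRingCat.of k)).map
    (CommAlgCat.ofHom (MvPolynomial.aeval c) : entryAlgebra k n R a b ⟶ A).op

end

end HilbertQuiver

/-! Condition 1 fixes the maps `μ_i`, so a point of `C^p` over `A` is determined by the entries of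
`(ρ, M)`, that is, by an `A`-point of an affine space (`Rep.ext_entry`, `Rep.entry_ofEntry`).
Condition 4 is a system of polynomial equations in these entries, hence closed. Conditions 2 and 3
say that the columns of `ρ` and of the block matrix `(M_0 | … | M_n)` generate a free module. By
Cramer's rule this means that the maximal minors generate the unit ideal, which is an open
condition. Both hold exactly when the product of the two minor ideals is the unit ideal.

So with `I = commIdeal` and `J = minorIdeal`, the scheme `C^p` is the complement of `V(J)` in
`V(I)`. Its `A`-points are the algebra maps that kill `I` and send `J` to generators of the unit
ideal (`exists_immersion_of_ideals`), and by `isAdmissible_ofEntry_iff_ideal` these are the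
admissible tuples. An immersion is a monomorphism, so bijectivity and naturality can be checked on
matrix entries. -/

/-! ### Generation by vectors and maximal minors -/

/-- A finite family of vectors in `A^m` generates if and only if its maximal minors generate the
unit ideal. -/
theorem Submodule.span_range_eq_top_iff_span_det_eq_top {A m ι : Type*} [CommRing A] [Fintype m]
    [DecidableEq m] [Finite ι] (v : ι → m → A) :
    Submodule.span A (Set.range v) = ⊤ ↔
      Ideal.span (Set.range fun g : m → ι => Matrix.det (Matrix.of fun i => v (g i))) = ⊤ := by
  classical
  have := Fintype.ofFinite ι
  constructor
  · intro h
    have hc (i : m) : ∃ c : ι → A, ∑ t, c t • v t = Pi.single i 1 :=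
      (Submodule.mem_span_range_iff_exists_fun A).1 (h ▸ Submodule.mem_top)
    choose c hc using hc
    rw [Ideal.eq_top_iff_one, ← Matrix.det_one (n := m) (R := A)]
    have h1 : (1 : Matrix m m A) = fun i => ∑ t, c i t • v t := by
      ext i j
      rw [hc, Matrix.one_apply, Pi.single_apply]
      simp only [eq_comm]
    -- Multilinear expansion in the rows. The sum runs over all maps `g`; those that are not
    -- injective repeat a row and contribute zero.
    have h2 : Matrix.det (1 : Matrix m m A) =
        ∑ g : m → ι, (∏ i, c i (g i)) • Matrix.det (Matrix.of fun i => v (g i)) := by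
      rw [h1]
      change (Matrix.detRowAlternating (n := m) (R := A)).toMultilinearMap _ = _
      rw [MultilinearMap.map_sum]
      refine Finset.sum_congr rfl fun g _ => ?_
      rw [MultilinearMap.map_smul_univ]
      rfl
    rw [h2]
    exact Ideal.sum_mem _ fun g _ => Ideal.mul_mem_left _ _ (Ideal.subset_span ⟨g, rfl⟩)
  · intro h
    rw [eq_top_iff]
    intro x _
    -- The scalars `c` with `c • x` in the span form an ideal. By Cramer's rule, `x · adj(V) · V =
    -- det(V) x`, it contains every maximal minor, hence `1`.
    have key : Ideal.span (Set.range fun g : m → ι => Matrix.det (Matrix.of fun i => v (g i))) ≤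
        (Submodule.span A (Set.range v)).comap (LinearMap.toSpanSingleton A (m → A) x) := by
      rw [Ideal.span, Submodule.span_le]
      rintro _ ⟨g, rfl⟩
      have h3 : Matrix.det (Matrix.of fun i => v (g i)) • x =
          ∑ i, (Matrix.vecMul x (Matrix.of fun i => v (g i)).adjugate) i • v (g i) := by
        have := congrArg (Matrix.vecMul x) (Matrix.adjugate_mul (Matrix.of fun i => v (g i)))
        rw [← Matrix.vecMul_vecMul, Matrix.vecMul_smul, Matrix.vecMul_one] at this
        rw [← this, Matrix.vecMul_eq_sum]
        rfl
      rw [SetLike.mem_coe, Submodule.mem_comap, LinearMap.toSpanSingleton_apply, h3]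
      exact Submodule.sum_mem _ fun i _ =>
        Submodule.smul_mem _ _ (Submodule.subset_span ⟨g i, rfl⟩)
    have h1 := key (h ▸ Submodule.mem_top : (1 : A) ∈ _)
    simpa using h1

/-! ### Matrix entries as coordinates on representations -/

namespace HilbertQuiver

noncomputable section

variable {n R a b : ℕ} {A B : Type u} [CommRing A] [CommRing B]

instance finite_monomials (n : ℕ) (d : ℤ) :
    Finite {m : Fin (n + 1) →₀ ℕ | (m.degree : ℤ) = d} :=
  -- For negative `d` the set is empty, so replacing `d` by `d.toNat = 0` does no harm.
  Set.Finite.subset (Finsupp.finite_of_degree_eq d.toNat) fun m hm => by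
    simp only [Set.mem_ofPred_eq] at hm ⊢
    omega

lemma X_mul_mem_gradedPiece (i : Fin (n + 1)) {f : MvPolynomial (Fin (n + 1)) A}
    (hf : f ∈ gradedPiece A n ((R : ℤ) - 1)) :
    MvPolynomial.X i * f ∈ gradedPiece A n R := by
  classical
  intro m hm
  have hm' : m ∈ (MvPolynomial.X i * f).support := hm
  rw [MvPolynomial.support_X_mul, Finset.mem_map] at hm'
  obtain ⟨m', h', rfl⟩ := hm'
  have : (m'.degree : ℤ) = (R : ℤ) - 1 := hf h'
  simp only [Set.mem_ofPred_eq, addLeftEmbedding_apply, map_add, Finsupp.degree_single]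
  push_cast
  omega

/-- The multiplication by `x_i`, as a map `S_{A,R-1} → S_{A,R}`. -/
def mulX (A : Type u) [CommRing A] (n R : ℕ) (i : Fin (n + 1)) :
    gradedPiece A n ((R : ℤ) - 1) →ₗ[A] gradedPiece A n R :=
  (LinearMap.mulLeft A (MvPolynomial.X i)).restrict fun _ hf => X_mul_mem_gradedPiece i hf

/-- The representation with prescribed matrix entries whose maps `μ_i` are the multiplications by
the variables. -/
def Rep.ofEntry (c : Entry n R a b → A) : Rep n R a b A
  | _, _, .mu i => mulX A n R i
  | _, _, .rho => (gradedPieceBasis n A R).constr ℕ fun m s => c (.inl (s, m))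
  | _, _, .M l => (Pi.basisFun A (Fin a)).constr ℕ fun j s => c (.inr (l, s, j))

namespace Rep

lemma mu_ofEntry (c : Entry n R a b → A) (i : Fin (n + 1))
    (f : gradedPiece A n ((R : ℤ) - 1)) :
    ((ofEntry c).mu i f : MvPolynomial (Fin (n + 1)) A) = MvPolynomial.X i * f.1 :=
  rfl

lemma entry_inl (φ : Rep n R a b A) (s : Fin a)
    (m : {m : Fin (n + 1) →₀ ℕ // (m.degree : ℤ) = R}) :
    φ.entry (.inl (s, m)) = φ.rho (gradedPieceBasis n A R m) s := by
  have : gradedPieceBasis n A R m = ⟨MvPolynomial.monomial m.1 1,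
      (MvPolynomial.monomial_mem_restrictSupport A).2 (Or.inl m.2)⟩ :=
    Subtype.ext (gradedPieceBasis_coe n A R m)
  rw [this]
  rfl

lemma entry_inr (φ : Rep n R a b A) (l : Fin (n + 1)) (s : Fin b) (j : Fin a) :
    φ.entry (.inr (l, s, j)) = φ.M l (Pi.basisFun A (Fin a) j) s := by
  rw [Pi.basisFun_apply]
  rfl

/-- With `ext_entry`, this makes `entry` and `ofEntry` inverse bijections between entry tuples and
representations satisfying condition 1. -/
lemma entry_ofEntry (c : Entry n R a b → A) : (ofEntry c).entry = c := by
  ext (⟨s, m⟩ | ⟨l, s, j⟩)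
  · rw [entry_inl]
    exact congrFun ((gradedPieceBasis n A R).constr_basis ℕ (fun m s => c (.inl (s, m))) m) s
  · rw [entry_inr]
    exact congrFun ((Pi.basisFun A (Fin a)).constr_basis ℕ (fun j s => c (.inr (l, s, j))) j) s

/-- A representation whose maps `μ_i` are the multiplications by the variables is determined by
its matrix entries. -/
lemma ext_entry {φ ψ : Rep n R a b A}
    (hφ : ∀ (i : Fin (n + 1)) (f : gradedPiece A n ((R : ℤ) - 1)),
      (φ.mu i f : MvPolynomial (Fin (n + 1)) A) = MvPolynomial.X i * f.1)
    (hψ : ∀ (i : Fin (n + 1)) (f : gradedPiece A n ((R : ℤ) - 1)),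
      (ψ.mu i f : MvPolynomial (Fin (n + 1)) A) = MvPolynomial.X i * f.1)
    (h : φ.entry = ψ.entry) : φ = ψ := by
  funext v w e
  change Arrow n v w at e
  cases e with
  | mu i => exact LinearMap.ext fun f => Subtype.ext ((hφ i f).trans (hψ i f).symm)
  | rho =>
    refine (gradedPieceBasis n A R).ext fun m => funext fun s => ?_
    have := congrFun h (.inl (s, m))
    rwa [entry_inl, entry_inl] at this
  | M l =>
    refine (Pi.basisFun A (Fin a)).ext fun j => funext fun s => ?_
    have := congrFun h (.inr (l, s, j))
    rwa [entry_inr, entry_inr] at this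

section BaseChange

variable (f : A →+* B) (φ : Rep n R a b A)

lemma baseChange_mu (i : Fin (n + 1)) (x : gradedPiece A n ((R : ℤ) - 1)) :
    (φ.baseChange f).mu i (gradedPieceMap n f _ x) = gradedPieceMap n f _ (φ.mu i x) :=
  φ.baseChange_apply f (Arrow.mu i : (Vertex.one : Vertex n) ⟶ .two) x

lemma baseChange_rho (x : gradedPiece A n R) :
    (φ.baseChange f).rho (gradedPieceMap n f _ x) = piMap f a (φ.rho x) :=
  φ.baseChange_apply f (Arrow.rho : (Vertex.two : Vertex n) ⟶ .three) x

lemma baseChange_M (i : Fin (n + 1)) (x : Fin a → A) :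
    (φ.baseChange f).M i (piMap f a x) = piMap f b (φ.M i x) :=
  φ.baseChange_apply f (Arrow.M i : (Vertex.three : Vertex n) ⟶ .four) x

lemma entry_baseChange : (φ.baseChange f).entry = f ∘ φ.entry := by
  ext (⟨s, m⟩ | ⟨l, s, j⟩)
  · rw [Function.comp_apply, entry_inl, entry_inl, ← gradedPieceMap_basis n f, baseChange_rho]
    rfl
  · rw [Function.comp_apply, entry_inr, entry_inr, ← piMap_basis f, baseChange_M]
    rfl

/-- Allows every representation `ofEntry c` over a `k`-algebra to be treated as a specialisation of
the generic one, whose entries are the variables. -/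
lemma baseChange_ofEntry (c : Entry n R a b → A) :
    (ofEntry c).baseChange f = ofEntry (f ∘ c) := by
  refine ext_entry (fun i g => ?_) (mu_ofEntry _) ?_
  · have key : (gradedPiece B n R).subtype ∘ₗ ((ofEntry c).baseChange f).mu i =
        LinearMap.mulLeft B (MvPolynomial.X i) ∘ₗ (gradedPiece B n ((R : ℤ) - 1)).subtype := by
      refine (gradedPieceBasis n B _).ext fun m => ?_
      rw [← gradedPieceMap_basis n f]
      simp only [LinearMap.comp_apply, baseChange_mu, Submodule.subtype_apply,
        LinearMap.mulLeft_apply]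
      change MvPolynomial.map f ((ofEntry c).mu i _).1 = MvPolynomial.X i * MvPolynomial.map f _
      rw [mu_ofEntry, map_mul, MvPolynomial.map_X]
    exact LinearMap.congr_fun key g
  · rw [entry_baseChange, entry_ofEntry, entry_ofEntry]

end BaseChange

end Rep

/-! ### The equations and the maximal minors -/

/-- The matrix entries of `M_i ∘ ρ ∘ μ_j - M_j ∘ ρ ∘ μ_i`. -/
def commEntry (c : Entry n R a b → A)
    (t : (Fin (n + 1) × Fin (n + 1)) ×
      ({m : Fin (n + 1) →₀ ℕ | (m.degree : ℤ) = (R : ℤ) - 1} × Fin b)) : A :=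
  (Rep.ofEntry c).M t.1.1 ((Rep.ofEntry c).rho ((Rep.ofEntry c).mu t.1.2
      (gradedPieceBasis n A _ t.2.1))) t.2.2 -
    (Rep.ofEntry c).M t.1.2 ((Rep.ofEntry c).rho ((Rep.ofEntry c).mu t.1.1
      (gradedPieceBasis n A _ t.2.1))) t.2.2

/-- The maximal minors of the matrix of `ρ`. -/
def rhoMinor (c : Entry n R a b → A)
    (g : Fin a → {m : Fin (n + 1) →₀ ℕ // (m.degree : ℤ) = R}) : A :=
  Matrix.det (Matrix.of fun i s => c (.inl (s, g i)))

/-- The maximal minors of the matrix of `ΣM`. -/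
def sumMinor (c : Entry n R a b → A) (g : Fin b → Fin (n + 1) × Fin a) : A :=
  Matrix.det (Matrix.of fun i s => c (.inr ((g i).1, s, (g i).2)))

/-- Compatibility with ring maps expresses that these quantities are universal polynomials in the
entries. Here and in the next two lemmas it serves to compare the generic matrix with its
specialisations. -/
lemma map_commEntry (f : A →+* B) (c : Entry n R a b → A) (t) :
    f (commEntry c t) = commEntry (f ∘ c) t := by
  simp only [commEntry, map_sub, ← Rep.baseChange_ofEntry, ← gradedPieceMap_basis n f,
    Rep.baseChange_mu, Rep.baseChange_rho, Rep.baseChange_M]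
  rfl

lemma map_rhoMinor (f : A →+* B) (c : Entry n R a b → A) (g) :
    f (rhoMinor c g) = rhoMinor (f ∘ c) g := by
  rw [rhoMinor, RingHom.map_det]
  rfl

lemma map_sumMinor (f : A →+* B) (c : Entry n R a b → A) (g) :
    f (sumMinor c g) = sumMinor (f ∘ c) g := by
  rw [sumMinor, RingHom.map_det]
  rfl

lemma comm_ofEntry_iff (c : Entry n R a b → A) :
    (∀ i j : Fin (n + 1), (Rep.ofEntry c).M i ∘ₗ (Rep.ofEntry c).rho ∘ₗ (Rep.ofEntry c).mu j =
      (Rep.ofEntry c).M j ∘ₗ (Rep.ofEntry c).rho ∘ₗ (Rep.ofEntry c).mu i) ↔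
      ∀ t, commEntry c t = 0 := by
  constructor
  · rintro h ⟨⟨i, j⟩, m, s⟩
    exact sub_eq_zero.2 (congrFun (LinearMap.congr_fun (h i j) (gradedPieceBasis n A _ m)) s)
  · intro h i j
    exact (gradedPieceBasis n A _).ext fun m => funext fun s =>
      sub_eq_zero.1 (h ((i, j), (m, s)))

/-- The image of `ρ` is spanned by the images of the monomials, so the minor criterion applies to
the columns of its matrix. -/
lemma surjective_rho_iff (φ : Rep n R a b A) :
    Function.Surjective φ.rho ↔ Ideal.span (Set.range (rhoMinor φ.entry)) = ⊤ := by
  have hv : φ.rho ∘ gradedPieceBasis n A R = fun m s => φ.entry (.inl (s, m)) := by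
    ext m s
    exact (φ.entry_inl s m).symm
  rw [← LinearMap.range_eq_top, LinearMap.range_eq_map, ← (gradedPieceBasis n A R).span_eq,
    Submodule.map_span, ← Set.range_comp, hv,
    Submodule.span_range_eq_top_iff_span_det_eq_top]
  rfl

lemma range_sumM (φ : Rep n R a b A) : LinearMap.range φ.sumM =
    Submodule.span A (Set.range fun t : Fin (n + 1) × Fin a => fun s =>
      φ.entry (.inr (t.1, s, t.2))) := by
  apply le_antisymm
  · rintro _ ⟨x, rfl⟩
    simp only [Rep.sumM, LinearMap.sum_apply, LinearMap.comp_apply, LinearMap.proj_apply]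
    refine Submodule.sum_mem _ fun l _ => ?_
    rw [← (Pi.basisFun A (Fin a)).sum_repr (x l), map_sum]
    refine Submodule.sum_mem _ fun j _ => ?_
    rw [map_smul]
    refine Submodule.smul_mem _ _ (Submodule.subset_span ⟨(l, j), ?_⟩)
    ext s
    exact φ.entry_inr l s j
  · rw [Submodule.span_le]
    rintro _ ⟨⟨l, j⟩, rfl⟩
    refine ⟨Pi.single l (Pi.basisFun A (Fin a) j), ?_⟩
    ext s
    simp only [Rep.sumM, LinearMap.sum_apply, LinearMap.comp_apply, LinearMap.proj_apply]
    rw [Finset.sum_eq_single l (fun i _ hi => by rw [Pi.single_eq_of_ne hi, map_zero])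
      (fun h => absurd (Finset.mem_univ l) h), Pi.single_eq_same, φ.entry_inr]

lemma surjective_sumM_iff (φ : Rep n R a b A) :
    Function.Surjective φ.sumM ↔ Ideal.span (Set.range (sumMinor φ.entry)) = ⊤ := by
  rw [← LinearMap.range_eq_top, range_sumM, Submodule.span_range_eq_top_iff_span_det_eq_top]
  rfl

/-- A product of ideals lies in each factor, so one unit-ideal condition encodes both
surjectivities. -/
lemma isAdmissible_ofEntry_iff (c : Entry n R a b → A) :
    (Rep.ofEntry c).IsAdmissible ↔ (∀ t, commEntry c t = 0) ∧
      Ideal.span (Set.range (rhoMinor c)) * Ideal.span (Set.range (sumMinor c)) = ⊤ := by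
  have hmul (I J : Ideal A) : I * J = ⊤ ↔ I = ⊤ ∧ J = ⊤ :=
    ⟨fun h => ⟨eq_top_mono Ideal.mul_le_left h, eq_top_mono Ideal.mul_le_right h⟩,
      fun h => by rw [h.1, h.2, Ideal.top_mul]⟩
  rw [hmul]
  constructor
  · intro h
    have h1 := (surjective_rho_iff _).1 h.surjective_rho
    have h2 := (surjective_sumM_iff _).1 h.surjective_sumM
    rw [Rep.entry_ofEntry] at h1 h2
    exact ⟨(comm_ofEntry_iff c).1 h.comm, h1, h2⟩
  · rintro ⟨h0, h1, h2⟩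
    refine ⟨Rep.mu_ofEntry c, ?_, ?_, (comm_ofEntry_iff c).2 h0⟩
    · rwa [surjective_sumM_iff, Rep.entry_ofEntry]
    · rwa [surjective_rho_iff, Rep.entry_ofEntry]

/-- The ideal generated by the entries of `M_i ∘ ρ ∘ μ_j - M_j ∘ ρ ∘ μ_i`. -/
def commIdeal (k : Type u) [Field k] (n R a b : ℕ) : Ideal (entryAlgebra k n R a b) :=
  Ideal.span (Set.range
    (commEntry (MvPolynomial.X : Entry n R a b → MvPolynomial (Entry n R a b) k)))

/-- The ideal generated by the products of the maximal minors of `ρ` and of `ΣM`. -/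
def minorIdeal (k : Type u) [Field k] (n R a b : ℕ) : Ideal (entryAlgebra k n R a b) :=
  Ideal.span (Set.range
    (rhoMinor (MvPolynomial.X : Entry n R a b → MvPolynomial (Entry n R a b) k))) *
  Ideal.span (Set.range
    (sumMinor (MvPolynomial.X : Entry n R a b → MvPolynomial (Entry n R a b) k)))

/-- The equations and minors of `c` are the images under `aeval c` of the generic ones, which
generate the two ideals. -/
lemma isAdmissible_ofEntry_iff_ideal {k : Type u} [Field k] [Algebra k A]
    (c : Entry n R a b → A) :
    (Rep.ofEntry c).IsAdmissible ↔
      commIdeal k n R a b ≤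
        RingHom.ker ((MvPolynomial.aeval c : MvPolynomial (Entry n R a b) k →ₐ[k] A) :
          MvPolynomial (Entry n R a b) k →+* A) ∧
      (minorIdeal k n R a b).map
        ((MvPolynomial.aeval c : MvPolynomial (Entry n R a b) k →ₐ[k] A) :
          MvPolynomial (Entry n R a b) k →+* A) = ⊤ := by
  set f : MvPolynomial (Entry n R a b) k →+* A :=
    ((MvPolynomial.aeval c : MvPolynomial (Entry n R a b) k →ₐ[k] A) :
      MvPolynomial (Entry n R a b) k →+* A)
  have hf : f ∘ (MvPolynomial.X : Entry n R a b → MvPolynomial (Entry n R a b) k) = c := by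
    ext t
    exact MvPolynomial.aeval_X c t
  rw [isAdmissible_ofEntry_iff]
  refine and_congr ?_ ?_
  · rw [commIdeal, Ideal.span_le, Set.range_subset_iff]
    refine forall_congr' fun t => ?_
    rw [SetLike.mem_coe, RingHom.mem_ker, map_commEntry, hf]
  · rw [minorIdeal, Ideal.map_mul, Ideal.map_span, Ideal.map_span, ← Set.range_comp,
      ← Set.range_comp]
    have h1 : f ∘ rhoMinor MvPolynomial.X = rhoMinor c := by
      ext g
      rw [Function.comp_apply, map_rhoMinor, hf]
    have h2 : f ∘ sumMinor MvPolynomial.X = sumMinor c := by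
      ext g
      rw [Function.comp_apply, map_sumMinor, hf]
    rw [h1, h2]

end

end HilbertQuiver

/-! ### Points of a locally closed subscheme of an affine scheme -/

namespace HilbertQuiver

noncomputable section

/-- Ideals `I` and `J` of a `k`-algebra `P` define a locally closed subscheme of `Spec P`, the
complement of `V(J)` in `V(I)`. An `A`-point of `Spec P` lies in it if and only if it kills `I`
and `J` generates the unit ideal of `A`. -/
theorem exists_immersion_of_ideals (k : Type u) [Field k] (P : CommAlgCat.{u} k) (I J : Ideal P) :
    ∃ (C : Over (Spec (CommRingCat.of k)))
      (j : C ⟶ (algSpec (CommRingCat.of k)).obj (Opposite.op P)),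
      IsImmersion j.left ∧ Mono j ∧ ∀ (A : CommAlgCat.{u} k) (γ : P ⟶ A),
        (∃ x : (algSpec (CommRingCat.of k)).obj (Opposite.op A) ⟶ C,
          x ≫ j = (algSpec (CommRingCat.of k)).map γ.op) ↔
        I ≤ RingHom.ker (γ.hom : P →+* A) ∧ J.map (γ.hom : P →+* A) = ⊤ := by
  have hfull : (algSpec (CommRingCat.of k)).Full := algSpec.instFull
  have hfaithful : (algSpec (CommRingCat.of k)).Faithful := algSpec.instFaithful
  let Q : CommAlgCat.{u} k := CommAlgCat.of k (P ⧸ I)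
  let q : P ⟶ Q := CommAlgCat.ofHom (Ideal.Quotient.mkₐ k I)
  let Z := (algSpec (CommRingCat.of k)).obj (Opposite.op Q)
  let U : Z.left.Opens :=
    ⟨(PrimeSpectrum.zeroLocus (J.map (Ideal.Quotient.mk I) : Set (P ⧸ I)))ᶜ,
      (PrimeSpectrum.isClosed_zeroLocus _).isOpen_compl⟩
  let C : Over (Spec (CommRingCat.of k)) := Over.mk (U.ι ≫ Z.hom)
  let ι : C ⟶ Z := Over.homMk U.ι rfl
  let z := (algSpec (CommRingCat.of k)).map q.op
  have hz : IsClosedImmersion z.left :=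
    IsClosedImmersion.spec_of_surjective (CommRingCat.ofHom (Ideal.Quotient.mk I))
      Ideal.Quotient.mk_surjective
  have hι : IsOpenImmersion ι.left := inferInstanceAs (IsOpenImmersion U.ι)
  have hj : IsImmersion (ι ≫ z).left := by
    rw [Over.comp_left]
    infer_instance
  have hmem (A : CommAlgCat.{u} k) (δ : Q ⟶ A) :
      (∃ x : (algSpec (CommRingCat.of k)).obj (Opposite.op A) ⟶ C,
        x ≫ ι = (algSpec (CommRingCat.of k)).map δ.op) ↔
      (J.map (Ideal.Quotient.mk I)).map (δ.hom : Q →+* A) = ⊤ := by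
    -- Lifting through an open immersion is a condition on the underlying points only.
    let d : _ ⟶ Z.left := ((algSpec (CommRingCat.of k)).map δ.op).left
    have h1 : (∃ x : (algSpec (CommRingCat.of k)).obj (Opposite.op A) ⟶ C,
        x ≫ ι = (algSpec (CommRingCat.of k)).map δ.op) ↔ Set.range d ⊆ Set.range U.ι := by
      constructor
      · rintro ⟨x, hx⟩
        have : d = x.left ≫ U.ι := congrArg (·.left) hx.symm
        rw [this]
        rintro _ ⟨y, rfl⟩
        exact ⟨x.left y, (Scheme.Hom.comp_apply _ _ _).symm⟩
      · intro h
        refine ⟨Over.homMk (IsOpenImmersion.lift U.ι d h) ?_, ?_⟩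
        · change IsOpenImmersion.lift U.ι d h ≫ U.ι ≫ Z.hom = _
          rw [IsOpenImmersion.lift_fac_assoc]
          exact Over.w ((algSpec (CommRingCat.of k)).map δ.op)
        · ext : 1
          exact IsOpenImmersion.lift_fac U.ι d h
    rw [h1, Scheme.Opens.range_ι]
    constructor
    · intro h
      -- Otherwise `J` maps into a maximal ideal, and this point of `Spec A` lands in `V(J)`,
      -- outside `U`.
      by_contra hne
      obtain ⟨m, hm, hle⟩ := Ideal.exists_le_maximal _ hne
      have := h ⟨(⟨m, hm.isPrime⟩ : PrimeSpectrum A), rfl⟩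
      exact this fun x hx => hle (Ideal.mem_map_of_mem (δ.hom : Q →+* A) hx)
    · rintro h _ ⟨y, rfl⟩ hy
      exact (y : PrimeSpectrum A).isPrime.ne_top
        (eq_top_mono (Ideal.map_le_iff_le_comap.2 hy) h)
  refine ⟨C, ι ≫ z, hj, Over.mono_of_mono_left _, fun A γ => ?_⟩
  constructor
  · rintro ⟨x, hx⟩
    -- By full faithfulness of `algSpec`, a map to `V(I)` comes from an algebra map out of `P ⧸ I`;
    -- hence `γ` kills `I`.
    obtain ⟨δ, hδ⟩ := (algSpec (CommRingCat.of k)).map_surjective (x ≫ ι)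
    have hγ : γ = q ≫ δ.unop := by
      apply Quiver.Hom.op_inj
      apply (algSpec (CommRingCat.of k)).map_injective
      rw [← hx, ← Category.assoc, ← hδ, ← Functor.map_comp]
      rfl
    have h := (hmem A δ.unop).1 ⟨x, hδ.symm⟩
    subst hγ
    constructor
    · intro f hf
      change δ.unop.hom (Ideal.Quotient.mk I f) = 0
      rw [Ideal.Quotient.eq_zero_iff_mem.2 hf, map_zero]
    · rw [Ideal.map_map] at h
      exact h
  · rintro ⟨hI, hJ⟩
    let δ : Q ⟶ A := CommAlgCat.ofHom (Ideal.Quotient.liftₐ I γ.hom fun f hf => hI hf)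
    have hγ : γ = q ≫ δ := by
      ext f
      rfl
    obtain ⟨x, hx⟩ := (hmem A δ).2 (by rw [Ideal.map_map]; exact hJ)
    refine ⟨x, ?_⟩
    rw [← Category.assoc, hx, ← Functor.map_comp, hγ]
    rfl

end

end HilbertQuiver

/-! ### Points of the matrix space and representability -/

namespace HilbertQuiver

noncomputable section

section MatrixPoint

variable {k : Type u} [Field k] {n R a b : ℕ}

/-- With the next lemma: algebra maps out of a polynomial ring correspond to arbitrary values of the
variables. -/
lemma matrixPoint_injective (A : CommAlgCat.{u} k) :
    Function.Injective (matrixPoint (n := n) (R := R) (a := a) (b := b) A) := by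
  have hfaithful : (algSpec (CommRingCat.of k)).Faithful := algSpec.instFaithful
  intro c d h
  have h1 := Quiver.Hom.op_inj ((algSpec (CommRingCat.of k)).map_injective h)
  have h2 : (MvPolynomial.aeval c : MvPolynomial (Entry n R a b) k →ₐ[k] A) =
      MvPolynomial.aeval d := congrArg CommAlgCat.Hom.hom h1
  ext t
  rw [← MvPolynomial.aeval_X (R := k) c t, h2, MvPolynomial.aeval_X]

lemma matrixPoint_surjective (A : CommAlgCat.{u} k) :
    Function.Surjective (matrixPoint (n := n) (R := R) (a := a) (b := b) A) := by
  have hfull : (algSpec (CommRingCat.of k)).Full := algSpec.instFull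
  intro y
  obtain ⟨γ, rfl⟩ := (algSpec (CommRingCat.of k)).map_surjective y
  let g : MvPolynomial (Entry n R a b) k →ₐ[k] A := γ.unop.hom
  refine ⟨fun t => g (MvPolynomial.X t), ?_⟩
  exact congrArg (fun h => (algSpec (CommRingCat.of k)).map (CommAlgCat.ofHom h).op)
    (MvPolynomial.aeval_unique g).symm

lemma algSpec_map_comp_matrixPoint {A B : CommAlgCat.{u} k} (g : A ⟶ B)
    (c : Entry n R a b → A) :
    (algSpec (CommRingCat.of k)).map g.op ≫ matrixPoint A c =
      matrixPoint B ((g.hom : A →+* B) ∘ c) := by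
  refine ((algSpec (CommRingCat.of k)).map_comp _ _).symm.trans
    (congrArg (fun h : MvPolynomial (Entry n R a b) k →ₐ[k] B =>
      (algSpec (CommRingCat.of k)).map (CommAlgCat.ofHom h).op)
      (?_ : g.hom.comp (MvPolynomial.aeval c) = MvPolynomial.aeval ((g.hom : A →+* B) ∘ c)))
  refine MvPolynomial.algHom_ext fun t => ?_
  change g.hom (MvPolynomial.aeval c (MvPolynomial.X t)) = MvPolynomial.aeval _ (MvPolynomial.X t)
  rw [MvPolynomial.aeval_X, MvPolynomial.aeval_X]
  rfl

end MatrixPoint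

/-- The functor `C^p` is represented by a locally closed subscheme of the space of matrices. -/
theorem exists_representing_immersion (k : Type u) [Field k] (n R a b : ℕ) :
    ∃ (C : Over (Spec (CommRingCat.of k))) (e : pointFunctor k C ≅ CpFunctor k n R a b)
      (j : C ⟶ matrixSpace k n R a b), IsImmersion j.left ∧
        ∀ (A : CommAlgCat.{u} k)
          (x : (algSpec (CommRingCat.of k)).obj (Opposite.op A) ⟶ C),
          x ≫ j = matrixPoint A (e.hom.app A x).1.entry := by
  obtain ⟨C, j, hj, hmono, hfac⟩ := exists_immersion_of_ideals k (entryAlgebra k n R a b)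
    (commIdeal k n R a b) (minorIdeal k n R a b)
  have hlift (A : CommAlgCat.{u} k) (c : Entry n R a b → A) :
      (∃ x : (algSpec (CommRingCat.of k)).obj (Opposite.op A) ⟶ C, x ≫ j = matrixPoint A c) ↔
        (Rep.ofEntry c).IsAdmissible :=
    (hfac A (CommAlgCat.ofHom (MvPolynomial.aeval c))).trans
      (isAdmissible_ofEntry_iff_ideal (k := k) c).symm
  have hpoint (A : CommAlgCat.{u} k)
      (x : (algSpec (CommRingCat.of k)).obj (Opposite.op A) ⟶ C) :
      ∃ φ : CpPoint n R a b A, x ≫ j = matrixPoint A φ.1.entry := by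
    obtain ⟨c, hc⟩ := matrixPoint_surjective A (x ≫ j)
    refine ⟨⟨Rep.ofEntry c, (hlift A c).1 ⟨x, hc.symm⟩⟩, ?_⟩
    exact hc.symm.trans (congrArg (matrixPoint A) (Rep.entry_ofEntry c).symm)
  choose F hF using hpoint
  -- Condition 1 holds on both sides, so the entries decide equality.
  have huniq (A : CommAlgCat.{u} k) (φ ψ : CpPoint n R a b A)
      (h : matrixPoint A φ.1.entry = matrixPoint A ψ.1.entry) : φ = ψ :=
    Subtype.ext (Rep.ext_entry φ.2.mu_apply ψ.2.mu_apply (matrixPoint_injective A h))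
  -- Injectivity holds because `j` is a monomorphism; surjectivity is the existence of lifts in
  -- `hlift`.
  have hbij (A : CommAlgCat.{u} k) : Function.Bijective (F A) := by
    constructor
    · intro x y h
      rw [← cancel_mono j, hF, hF, h]
    · intro φ
      have hφ : Rep.ofEntry φ.1.entry = φ.1 :=
        Rep.ext_entry (Rep.mu_ofEntry _) φ.2.mu_apply (Rep.entry_ofEntry _)
      obtain ⟨x, hx⟩ := (hlift A φ.1.entry).2 (hφ.symm ▸ φ.2)
      exact ⟨x, huniq A _ _ (by rw [← hF, hx])⟩
  let e : pointFunctor k C ≅ CpFunctor k n R a b :=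
    NatIso.ofComponents (fun A => (Equiv.ofBijective (F A) (hbij A)).toIso) fun {A B} g => by
      ext x
      apply huniq B
      change matrixPoint B (F B ((algSpec (CommRingCat.of k)).map g.op ≫ x)).1.entry =
        matrixPoint B ((F A x).1.baseChange (g.hom : A →+* B)).entry
      exact (hF B _).symm.trans <| (Category.assoc _ _ _).trans <|
        (congrArg ((algSpec (CommRingCat.of k)).map g.op ≫ ·) (hF A x)).trans <|
        (algSpec_map_comp_matrixPoint g _).trans <|
        congrArg (matrixPoint B) (Rep.entry_baseChange _ _).symm
  exact ⟨C, e, j, hj, hF⟩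

/-! ### Dimension vectors and underlying quiver representations -/

lemma card_monomials (n d : ℕ) :
    Nat.card {m : Fin (n + 1) →₀ ℕ | (m.degree : ℤ) = d} = (d + n).choose d := by
  have h : {m : Fin (n + 1) →₀ ℕ | (m.degree : ℤ) = d} =
      ((Finset.univ : Finset (Fin (n + 1))).finsuppAntidiag d : Set (Fin (n + 1) →₀ ℕ)) := by
    ext m
    rw [Set.mem_ofPred_eq, Nat.cast_inj]
    simp [Finsupp.degree_eq_sum]
  rw [h, Nat.card_coe_set_eq, Set.ncard_coe_finset, Finset.card_finsuppAntidiag_nat_eq_choose,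
    Finset.card_univ, Fintype.card_fin]
  congr 1
  omega

lemma finrank_gradedPiece (k : Type u) [Field k] (n d : ℕ) :
    Module.finrank k (gradedPiece k n d) = (d + n).choose d := by
  rw [Module.finrank_eq_nat_card_basis (gradedPieceBasis n k d), card_monomials]

lemma finrank_gradedPiece_neg_one (k : Type u) [Field k] (n : ℕ) :
    Module.finrank k (gradedPiece k n (((0 : ℕ) : ℤ) - 1)) = 0 := by
  have : IsEmpty {m : Fin (n + 1) →₀ ℕ | (m.degree : ℤ) = ((0 : ℕ) : ℤ) - 1} :=
    ⟨fun m => by have : (m.1.degree : ℤ) = ((0 : ℕ) : ℤ) - 1 := m.2; omega⟩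
  rw [Module.finrank_eq_nat_card_basis (gradedPieceBasis n k _), Nat.card_of_isEmpty]

lemma finrank_vertexSpace (k : Type u) [Field k] (n R a b : ℕ) (v : Vertex n) :
    Module.finrank k (vertexSpace n R a b k v) = dimVector n R a b v := by
  cases v with
  | one =>
    cases R with
    -- No monomial has degree `-1`, in agreement with the entry `0` of `dimVector`.
    | zero => exact finrank_gradedPiece_neg_one k n
    | succ R =>
      have h : ((R + 1 : ℕ) : ℤ) - 1 = (R : ℤ) := by push_cast; ring
      change Module.finrank k (gradedPiece k n (((R + 1 : ℕ) : ℤ) - 1)) = _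
      rw [h]
      exact finrank_gradedPiece k n R
  | two => exact finrank_gradedPiece k n R
  | three => exact Module.finrank_fin_fun k
  | four => exact Module.finrank_fin_fun k

lemma Rep.toQuiverRep_injective {n R a b : ℕ} {A : Type u} [CommRing A] :
    Function.Injective (Rep.toQuiverRep : Rep n R a b A → QuiverRep A n) := by
  intro φ ψ h
  injection h with _ h
  funext v w e
  have h1 : ModuleCat.ofHom (φ v w e) = ModuleCat.ofHom (ψ v w e) :=
    congrFun (congrFun (congrFun h v) w) e
  exact congrArg ModuleCat.Hom.hom h1

end

end HilbertQuiver

/-! ### The proposition -/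

theorem mainTheorem10 (k : Type u) [Field k] (n : ℕ) (p : Polynomial ℚ)
    (hp : HilbertQuiver.IsHilbertPolynomial k n p)
    (r : ℕ) (hr : HilbertQuiver.IsGotzmannNumber p r) (R : ℕ) (hR : r ≤ R)
    (a b : ℕ) (ha : (a : ℚ) = p.eval (R : ℚ)) (hb : (b : ℚ) = p.eval ((R : ℚ) + 1)) :
    ∃ (C : Over (Spec (CommRingCat.of k)))
      (e : HilbertQuiver.pointFunctor k C ≅ HilbertQuiver.CpFunctor k n R a b),
      (∃ j : C ⟶ HilbertQuiver.matrixSpace k n R a b, IsImmersion j.left ∧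
        ∀ (A : CommAlgCat.{u} k)
          (x : (algSpec (CommRingCat.of k)).obj (Opposite.op A) ⟶ C),
          x ≫ j = HilbertQuiver.matrixPoint A (e.hom.app A x).1.entry) ∧
      Set.BijOn
        (fun x : (algSpec (CommRingCat.of k)).obj (Opposite.op (CommAlgCat.of k k)) ⟶ C =>
          (e.hom.app (CommAlgCat.of k k) x).1.toQuiverRep)
        Set.univ
        {F : HilbertQuiver.QuiverRep k n |
          ∃ φ : HilbertQuiver.Rep n R a b k, φ.IsAdmissible ∧ φ.toQuiverRep = F} ∧
      ∀ (x : (algSpec (CommRingCat.of k)).obj (Opposite.op (CommAlgCat.of k k)) ⟶ C)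
        (v : HilbertQuiver.Vertex n),
        Module.finrank k ((e.hom.app (CommAlgCat.of k k) x).1.toQuiverRep.obj v) =
          HilbertQuiver.dimVector n R a b v := by

  obtain ⟨C, e, j, hj, hpoint⟩ := HilbertQuiver.exists_representing_immersion k n R a b
  -- The bijection at `A = k` gives the claim on `k`-points, because passing to the underlying
  -- quiver representation is injective.
  have hbij := (e.app (CommAlgCat.of k k)).toEquiv.bijective
  refine ⟨C, e, ⟨j, hj, hpoint⟩, ⟨fun x _ => ⟨_, (e.hom.app (CommAlgCat.of k k) x).2, rfl⟩,
    fun x _ y _ h => hbij.1 (Subtype.ext (HilbertQuiver.Rep.toQuiverRep_injective h)), ?_⟩,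
    fun x v => HilbertQuiver.finrank_vertexSpace k n R a b v⟩
  rintro _ ⟨φ, hφ, rfl⟩
  obtain ⟨x, hx⟩ := hbij.2 ⟨φ, hφ⟩
  exact ⟨x, trivial, congrArg (fun ψ => ψ.1.toQuiverRep) hx⟩
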